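/- **Setting.** Let $\mathfrak X=\{x\in\mathbb R^n: x_{\min}\le x\le x_{\max}\}$ be a box and $\mathfrak X^\star\supseteq\mathfrak X$ a compact convex subset of $\mathbb R^n$; for $S\subseteq\mathbb R^n$ let $\mathcal M(S)$ be the set of Borel probability measures on $\mathbb R^n$ supported on $S$ (giving full measure to $S$). Let $d$ be the order-1 Wasserstein distance with respect to the $\ell_1$-norm, $d(\mu,\nu)=\inf_{\Pi}\int\|\xi-\xi'\|_1\,d\Pi(\xi,\xi')$ over couplings $\Pi$ of $\mu$ and $\nu$. The noise is additive and independent of the latent vector: a probability distribution $\mathbb F_E$ on $\mathbb R^n$ is given such that for every $x\in\mathfrak X$ the law $\mathbb O(\cdot\mid x)$ of $x+E$, $E\sim\mathbb F_E$, belongs to $\mathcal M(\mathfrak X^\star)$; put $T_{\mathbb O}(\mathbb Q)(A)=\int \mathbb O(A\mid x)\,d\mathbb Q(x)$ for $\mathbb Q\in\mathcal M(\mathfrak X)$. Let $\mathbb F\in\mathcal M(\mathfrak X)$ be the latent distribution and $\mathbb F^\star=T_{\mathbb O}(\mathbb F)$. Let $\widehat X_1^\star,\widehat X_2^\star,\dots$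 be i.i.d. random vectors with law $\mathbb F^\star$, and $\widehat{\mathbb F}^\star_N=\frac1N\sum_{j=1}^N\delta_{\widehat X_j^\star}$. For $\varepsilon\ge 0$ let $$\mathcal B_{\varepsilon,\mathbb O}(\widehat{\mathbb F}^\star_N)=\{\mathbb Q\in\mathcal M(\mathfrak X): d(T_{\mathbb O}(\mathbb Q),\widehat{\mathbb F}^\star_N)\le\varepsilon\}.$$ Let $U:\mathbb R\to\mathbb R$ be continuous, concave and nondecreasing, and $\mathcal W\subseteq\mathbb R^n$ a feasible set. Assume that for every $w\in\mathcal W$ the map $x\mapsto U(\langle w,x\rangle)$ is Lipschitz on $\mathfrak X$ with respect to $\|\cdot\|_1$ (the constant may depend on $w$). **Radii.** Let $\beta_N\in(0,1)$ satisfy $\sum_{N\ge1}\beta_N<\infty$. Let $\varepsilon^{\min}_N(\beta)$ be the smallest $r\ge0$ such that $\mathbb F^\star$ satisfies $d(\mathbb F^\star,\widehat{\mathbb F}^\star_N)\le r$ with probability at least $1-\beta$. Let $\varepsilon_N=\varepsilon_N(\beta_N)$ be any real numbers with $\varepsilon_N\ge\varepsilon^{\min}_N(\beta_N)$ for all $N\ge1$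 and $\lim_{N\to\infty}\varepsilon_N=0$. Define, with values in $[-\infty,+\infty]$ and with the infimum over the empty set equal to $+\infty$, $$\widehat g^*_{\mathrm{noise},N}=\sup_{w\in\mathcal W}\ \inf_{\mathbb Q\in\mathcal B_{\varepsilon_N,\mathbb O}(\widehat{\mathbb F}^\star_N)}\mathbb E^{\mathbb Q}[U(\langle w,X\rangle)],\qquad g^*_{SO}=\sup_{w\in\mathcal W}\mathbb E^{\mathbb F}[U(\langle w,X\rangle)].$$ **Theorem (Asymptotic Consistency).** (i) With probability one, $\lim_{N\to\infty}\widehat g^*_{\mathrm{noise},N}=g^*_{SO}$. (ii) If in addition $\mathcal W$ is compact, then with probability one the following holds: for every sequence $(\widehat w^*_{\mathrm{noise},N})_{N\ge1}$ in $\mathcal W$ such that each $\widehat w^*_{\mathrm{noise},N}$ attains the supremum defining $\widehat g^*_{\mathrm{noise},N}$, every accumulation point $\bar w$ of the sequence is an optimal solution of the true problem, i.e. $\bar w\in\mathcal W$ and $\mathbb E^{\mathbb F}[U(\langle\bar w,X\rangle)]=g^*_{SO}$. -/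

import Mathlib

open MeasureTheory ProbabilityTheory Filter Topology
open scoped ENNReal

noncomputable section

namespace NoisyDRO

/-- The `ℓ¹` distance on `ℝⁿ`. -/
def l1dist {n : ℕ} (x y : Fin n → ℝ) : ℝ := ∑ i, |x i - y i|

/-- `probOn S` is the set of Borel probability measures on `ℝⁿ` supported on `S`, that is, giving
full measure to `S`. -/
def probOn {n : ℕ} (S : Set (Fin n → ℝ)) : Set (Measure (Fin n → ℝ)) :=
  {μ | IsProbabilityMeasure μ ∧ μ Sᶜ = 0}

/-- Couplings of `μ` and `ν`: joint distributions with first marginal `μ`, second marginal `ν`. -/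
def couplings {n : ℕ} (μ ν : Measure (Fin n → ℝ)) :
    Set (Measure ((Fin n → ℝ) × (Fin n → ℝ))) :=
  {π | π.map Prod.fst = μ ∧ π.map Prod.snd = ν}

/-- The Wasserstein distance of order `1` with respect to the `ℓ¹` norm, with values in `[0, ∞]`. -/
def wasserstein {n : ℕ} (μ ν : Measure (Fin n → ℝ)) : ℝ≥0∞ :=
  ⨅ π ∈ couplings μ ν, ∫⁻ p, ENNReal.ofReal (l1dist p.1 p.2) ∂π

/-- The Wasserstein ball of radius `ε` around `μ`, consisting of measures supported on `S`. -/
def wassersteinBall {n : ℕ} (S : Set (Fin n → ℝ)) (ε : ℝ) (μ : Measure (Fin n → ℝ)) :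
    Set (Measure (Fin n → ℝ)) :=
  {ν | ν ∈ probOn S ∧ wasserstein ν μ ≤ ENNReal.ofReal ε}

/-- The conditional distribution of the noisy vector `x + E` given the latent value `x`, where `E`
has distribution `FE`. -/
def obsDist {n : ℕ} (FE : Measure (Fin n → ℝ)) (x : Fin n → ℝ) : Measure (Fin n → ℝ) :=
  FE.map (fun e => x + e)

/-- The noise operator, sending a latent distribution `Q` to the marginal distribution
`A ↦ ∫ obsDist FE x A dQ(x)` of the noisy vector. -/
def noiseOp {n : ℕ} (FE Q : Measure (Fin n → ℝ)) : Measure (Fin n → ℝ) :=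
  Q.bind (obsDist FE)

lemma obsDist_apply {n : ℕ} (FE : Measure (Fin n → ℝ)) (x : Fin n → ℝ) {A : Set (Fin n → ℝ)}
    (hA : MeasurableSet A) : obsDist FE x A = FE {e | x + e ∈ A} :=
  Measure.map_apply (measurable_const_add x) hA

lemma measurable_obsDist {n : ℕ} (FE : Measure (Fin n → ℝ)) [SFinite FE] :
    Measurable (obsDist FE) := by
  refine Measure.measurable_of_measurable_coe _ fun A hA => ?_
  simp_rw [obsDist_apply FE _ hA]
  exact measurable_measure_prodMk_left (measurable_add hA)

lemma noiseOp_apply {n : ℕ} (FE Q : Measure (Fin n → ℝ)) [SFinite FE] {A : Set (Fin n → ℝ)}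
    (hA : MeasurableSet A) : noiseOp FE Q A = ∫⁻ x, obsDist FE x A ∂Q :=
  Measure.bind_apply hA (measurable_obsDist FE).aemeasurable

/-- Under additive independent noise, the noisy marginal is the convolution. -/
lemma noiseOp_eq_conv {n : ℕ} (FE Q : Measure (Fin n → ℝ)) [SFinite FE] [SFinite Q] :
    noiseOp FE Q = Measure.conv Q FE := by
  ext A hA
  rw [noiseOp_apply FE Q hA, Measure.conv, Measure.map_apply measurable_add hA,
    Measure.prod_apply (measurable_add hA)]
  simp_rw [obsDist_apply FE _ hA]
  rfl

/-- The empirical distribution of `N` sample points. -/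
def empirical {n N : ℕ} (x : Fin N → (Fin n → ℝ)) : Measure (Fin n → ℝ) :=
  (N : ℝ≥0∞)⁻¹ • ∑ j, Measure.dirac (x j)

/-- The ambiguity set over latent distributions: the inverse image under the noise operator of the
Wasserstein ball (of measures supported on `Xs`) of radius `ε` around the reference distribution
`ν`. -/
def noisyBall {n : ℕ} (X Xs : Set (Fin n → ℝ)) (FE : Measure (Fin n → ℝ)) (ε : ℝ)
    (ν : Measure (Fin n → ℝ)) : Set (Measure (Fin n → ℝ)) :=
  {Q | Q ∈ probOn X ∧ noiseOp FE Q ∈ wassersteinBall Xs ε ν}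

/-- The expected utility of the decision `w` under the distribution `Q`. -/
def expUtility {n : ℕ} (U : ℝ → ℝ) (Q : Measure (Fin n → ℝ)) (w : Fin n → ℝ) : ℝ :=
  ∫ x, U (w ⬝ᵥ x) ∂Q

/-- The worst-case expected utility of `w` over the ambiguity set (`+∞` if that set is empty). -/
def worstCase {n : ℕ} (X Xs : Set (Fin n → ℝ)) (FE : Measure (Fin n → ℝ)) (U : ℝ → ℝ) (ε : ℝ)
    (ν : Measure (Fin n → ℝ)) (w : Fin n → ℝ) : EReal :=
  ⨅ Q ∈ noisyBall X Xs FE ε ν, (expUtility U Q w : EReal)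

/-- The optimal value of the noisy-data distributionally robust problem. -/
def noiseValue {n : ℕ} (X Xs W : Set (Fin n → ℝ)) (FE : Measure (Fin n → ℝ)) (U : ℝ → ℝ) (ε : ℝ)
    (ν : Measure (Fin n → ℝ)) : EReal :=
  ⨆ w ∈ W, worstCase X Xs FE U ε ν w

/-- `w` is an optimal solution of the noisy-data distributionally robust problem. -/
def IsNoiseOptimal {n : ℕ} (X Xs W : Set (Fin n → ℝ)) (FE : Measure (Fin n → ℝ)) (U : ℝ → ℝ)
    (ε : ℝ) (ν : Measure (Fin n → ℝ)) (w : Fin n → ℝ) : Prop :=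
  w ∈ W ∧ worstCase X Xs FE U ε ν w = noiseValue X Xs W FE U ε ν

/-- The optimal value of the stochastic optimization problem under the distribution `F`. -/
def soValue {n : ℕ} (W : Set (Fin n → ℝ)) (U : ℝ → ℝ) (F : Measure (Fin n → ℝ)) : EReal :=
  ⨆ w ∈ W, (expUtility U F w : EReal)

/-- `w` is an optimal solution of the stochastic optimization problem under `F`. -/
def IsSOOptimal {n : ℕ} (W : Set (Fin n → ℝ)) (U : ℝ → ℝ) (F : Measure (Fin n → ℝ))
    (w : Fin n → ℝ) : Prop :=
  w ∈ W ∧ (expUtility U F w : EReal) = soValue W U F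

/-- The smallest radius `r ≥ 0` such that, with probability at least `1 - β` over `N` independent
samples from `G`, the distribution `G` lies in the Wasserstein ball of radius `r` around the
empirical distribution of these samples. -/
def confRadius {n : ℕ} (G : Measure (Fin n → ℝ)) (N : ℕ) (β : ℝ) : ℝ :=
  sInf {r : ℝ | 0 ≤ r ∧ ENNReal.ofReal (1 - β) ≤
    (Measure.pi fun _ : Fin N => G) {x | wasserstein G (empirical x) ≤ ENNReal.ofReal r}}

end NoisyDRO

end

/-! The noise operator is convolution with `FE`, so it multiplies characteristic functions by that
of `FE`. That factor may vanish, so naive division fails. But `FE` is a translate of a law on a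
compact set, so along each line through the origin its characteristic function extends to an entire
function equal to 1 at 0 and its zeros there are isolated. Characteristic functions of laws on the
box are equi-Lipschitz along such lines, so convergence just off a zero carries over to the zero
(`tendsto_coordCharFun_of_noiseOp`). Wasserstein closeness controls characteristic functions, and
Lévy's theorem then makes any selection from the shrinking ambiguity sets converge weakly to `F`
(`tendsto_integral_of_wasserstein_noiseOp_le`).

By Borel-Cantelli `F` almost surely lies in the ambiguity set eventually
(`ae_eventually_wasserstein_empirical_le`), so worst-case utilities lie below true ones. Conversely,
for each fixed `w` the weak convergence keeps the worst case above any level below the true utility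
(`eventually_le_worstCase`). Both bounds pass to the suprema, and continuity of the true utility in
`w` handles accumulation points. -/

namespace NoisyDRO

/-! ### Wasserstein distance to empirical measures, confidence radii, Borel-Cantelli -/

section Wasserstein

variable {n N : ℕ}

lemma l1dist_nonneg (x y : Fin n → ℝ) : 0 ≤ l1dist x y :=
  Finset.sum_nonneg fun _ _ => abs_nonneg _

lemma l1dist_triangle (x y z : Fin n → ℝ) : l1dist x z ≤ l1dist x y + l1dist y z := by
  simp only [l1dist, ← Finset.sum_add_distrib]
  exact Finset.sum_le_sum fun i _ => abs_sub_le _ _ _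

lemma continuous_l1dist : Continuous fun p : (Fin n → ℝ) × (Fin n → ℝ) => l1dist p.1 p.2 := by
  unfold l1dist
  fun_prop

lemma measurable_ofReal_l1dist :
    Measurable fun p : (Fin n → ℝ) × (Fin n → ℝ) => ENNReal.ofReal (l1dist p.1 p.2) :=
  continuous_l1dist.measurable.ennreal_ofReal

lemma isProbabilityMeasure_of_mem_couplings {μ ν : Measure (Fin n → ℝ)} [IsProbabilityMeasure μ]
    {π : Measure ((Fin n → ℝ) × (Fin n → ℝ))} (hπ : π ∈ couplings μ ν) :
    IsProbabilityMeasure π := by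
  have h : IsProbabilityMeasure (π.map Prod.fst) := by rw [hπ.1]; infer_instance
  exact (Measure.isProbabilityMeasure_map_iff measurable_fst.aemeasurable).1 h

/-- The mixture, with equal weights, of the measures `κ j` on the slices over the points `x j`. -/
noncomputable def sliceMixture (κ : Fin N → Measure (Fin n → ℝ)) (x : Fin N → (Fin n → ℝ)) :
    Measure ((Fin n → ℝ) × (Fin n → ℝ)) :=
  (N : ℝ≥0∞)⁻¹ • ∑ j, (κ j).map fun a => (a, x j)

lemma sliceMixture_map_fst (κ : Fin N → Measure (Fin n → ℝ)) (x : Fin N → (Fin n → ℝ)) :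
    (sliceMixture κ x).map Prod.fst = (N : ℝ≥0∞)⁻¹ • ∑ j, κ j := by
  rw [sliceMixture, Measure.map_smul, Measure.map_finset_sum measurable_fst.aemeasurable]
  congr 1
  refine Finset.sum_congr rfl fun j _ => ?_
  rw [Measure.map_map measurable_fst (by fun_prop)]
  exact Measure.map_id

lemma sliceMixture_map_snd (κ : Fin N → Measure (Fin n → ℝ)) [∀ j, IsProbabilityMeasure (κ j)]
    (x : Fin N → (Fin n → ℝ)) : (sliceMixture κ x).map Prod.snd = empirical x := by
  rw [sliceMixture, Measure.map_smul, Measure.map_finset_sum measurable_snd.aemeasurable, empirical]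
  congr 1
  refine Finset.sum_congr rfl fun j _ => ?_
  rw [Measure.map_map measurable_snd (by fun_prop)]
  simp [Function.comp_def]

lemma lintegral_sliceMixture (κ : Fin N → Measure (Fin n → ℝ)) (x : Fin N → (Fin n → ℝ))
    {f : (Fin n → ℝ) × (Fin n → ℝ) → ℝ≥0∞} (hf : Measurable f) :
    ∫⁻ p, f p ∂(sliceMixture κ x) = (N : ℝ≥0∞)⁻¹ * ∑ j, ∫⁻ a, f (a, x j) ∂(κ j) := by
  rw [sliceMixture, lintegral_smul_measure, lintegral_finsetSum_measure, smul_eq_mul]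
  congr 1
  exact Finset.sum_congr rfl fun j _ => lintegral_map hf (by fun_prop)

lemma lintegral_empirical (x : Fin N → (Fin n → ℝ)) (f : (Fin n → ℝ) → ℝ≥0∞) :
    ∫⁻ a, f a ∂(empirical x) = (N : ℝ≥0∞)⁻¹ * ∑ j, f (x j) := by
  rw [empirical, lintegral_smul_measure, lintegral_finsetSum_measure, smul_eq_mul]
  simp

lemma isProbabilityMeasure_empirical (hN : N ≠ 0) (x : Fin N → (Fin n → ℝ)) :
    IsProbabilityMeasure (empirical x) := by
  refine ⟨?_⟩
  rw [← lintegral_one, lintegral_empirical x]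
  simp [ENNReal.inv_mul_cancel, hN]

/-- Every coupling with an empirical distribution is a mixture over the sample points. -/
lemma exists_eq_sliceMixture {G : Measure (Fin n → ℝ)} [IsProbabilityMeasure G]
    {x : Fin N → (Fin n → ℝ)} {π : Measure ((Fin n → ℝ) × (Fin n → ℝ))}
    (hπ : π ∈ couplings G (empirical x)) :
    ∃ κ : Fin N → Measure (Fin n → ℝ), (∀ j, IsProbabilityMeasure (κ j)) ∧
      π = sliceMixture κ x := by
  have := isProbabilityMeasure_of_mem_couplings hπ
  -- `condKernel` conditions on the first coordinate, hence the swap. Integrating against the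
  -- empirical marginal only sees the kernel at the points `x j`.
  obtain ⟨ρ, hρ⟩ : ∃ ρ, ρ = π.map Prod.swap := ⟨_, rfl⟩
  have hρp : IsProbabilityMeasure ρ :=
    hρ ▸ Measure.isProbabilityMeasure_map measurable_swap.aemeasurable
  have hfst : ρ.fst = empirical x := by
    rw [Measure.fst, hρ, Measure.map_map measurable_fst measurable_swap]
    exact hπ.2
  refine ⟨fun j => ρ.condKernel (x j), fun j => inferInstance, ?_⟩
  refine Measure.ext_of_lintegral _ fun f hf => ?_
  have hf' : Measurable fun p : (Fin n → ℝ) × (Fin n → ℝ) => f p.swap := hf.comp measurable_swap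
  calc ∫⁻ p, f p ∂π = ∫⁻ p, f p.swap ∂ρ := by
        rw [hρ, lintegral_map hf' measurable_swap]
        simp
    _ = ∫⁻ p, f p.swap ∂(ρ.fst ⊗ₘ ρ.condKernel) := by rw [Measure.disintegrate]
    _ = _ := by
        rw [Measure.lintegral_compProd hf', hfst, lintegral_empirical, lintegral_sliceMixture _ _ hf]
        rfl

/-- Keep the conditional laws of a coupling and move only their atoms from `x j` to `y j`: the cost
grows by at most the mean displacement. -/
lemma wasserstein_empirical_le (G : Measure (Fin n → ℝ)) [IsProbabilityMeasure G]
    (x y : Fin N → (Fin n → ℝ)) :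
    wasserstein G (empirical y) ≤ wasserstein G (empirical x) +
      (N : ℝ≥0∞)⁻¹ * ∑ j, ENNReal.ofReal (l1dist (x j) (y j)) := by
  conv_rhs => rw [wasserstein]
  simp only [ENNReal.iInf_add]
  refine le_iInf₂ fun π hπ => ?_
  obtain ⟨κ, hκ, rfl⟩ := exists_eq_sliceMixture hπ
  have hc : sliceMixture κ y ∈ couplings G (empirical y) :=
    ⟨by rw [← hπ.1, sliceMixture_map_fst, sliceMixture_map_fst], sliceMixture_map_snd κ y⟩
  refine (iInf₂_le _ hc).trans ?_
  rw [lintegral_sliceMixture _ _ measurable_ofReal_l1dist,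
    lintegral_sliceMixture _ _ measurable_ofReal_l1dist, ← mul_add, ← Finset.sum_add_distrib]
  gcongr with j
  calc ∫⁻ a, ENNReal.ofReal (l1dist a (y j)) ∂(κ j)
      ≤ ∫⁻ a, (ENNReal.ofReal (l1dist a (x j)) + ENNReal.ofReal (l1dist (x j) (y j))) ∂(κ j) := by
        refine lintegral_mono fun a => ?_
        rw [← ENNReal.ofReal_add (l1dist_nonneg _ _) (l1dist_nonneg _ _)]
        exact ENNReal.ofReal_le_ofReal (l1dist_triangle _ _ _)
    _ = _ := by rw [lintegral_add_right _ measurable_const]; simp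

lemma wasserstein_empirical_lt_top (hN : N ≠ 0) {K : Set (Fin n → ℝ)} (hK : IsCompact K)
    {G : Measure (Fin n → ℝ)} (hG : G ∈ probOn K) (x : Fin N → (Fin n → ℝ)) :
    wasserstein G (empirical x) < ∞ := by
  have := hG.1
  -- Equal slices give the independent coupling.
  have hc : sliceMixture (fun _ => G) x ∈ couplings G (empirical x) := by
    refine ⟨?_, sliceMixture_map_snd _ x⟩
    rw [sliceMixture_map_fst, Finset.sum_const, Finset.card_univ, Fintype.card_fin,
      ← Nat.cast_smul_eq_nsmul ℝ≥0∞, smul_smul, ENNReal.inv_mul_cancel (by simpa) (by simp),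
      one_smul]
  refine (iInf₂_le _ hc).trans_lt ?_
  rw [lintegral_sliceMixture _ _ measurable_ofReal_l1dist]
  refine ENNReal.mul_lt_top (by simpa [pos_iff_ne_zero]) (ENNReal.sum_lt_top.2 fun j _ => ?_)
  have hcont : Continuous fun a => l1dist a (x j) :=
    continuous_l1dist.comp (continuous_id.prodMk continuous_const)
  obtain ⟨C, hC⟩ := (hK.image hcont).bddAbove
  calc ∫⁻ a, ENNReal.ofReal (l1dist a (x j)) ∂G ≤ ∫⁻ _, ENNReal.ofReal C ∂G := by
        refine lintegral_mono_ae ?_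
        filter_upwards [mem_ae_iff.2 hG.2] with a ha
        exact ENNReal.ofReal_le_ofReal (hC ⟨a, ha, rfl⟩)
    _ < ∞ := by simp

/-- Supplies the measurability needed for continuity of measure and for passing to complements. -/
lemma isClosed_wasserstein_empirical_le (G : Measure (Fin n → ℝ)) [IsProbabilityMeasure G]
    (hN : N ≠ 0) (r : ℝ≥0∞) :
    IsClosed {x : Fin N → (Fin n → ℝ) | wasserstein G (empirical x) ≤ r} := by
  refine IsSeqClosed.isClosed fun u x hu hux => ?_
  have hD : Tendsto (fun k => r + (N : ℝ≥0∞)⁻¹ * ∑ j, ENNReal.ofReal (l1dist (u k j) (x j)))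
      atTop (𝓝 r) := by
    have h0 : Tendsto (fun k => ∑ j, ENNReal.ofReal (l1dist (u k j) (x j))) atTop
        (𝓝 (∑ j, ENNReal.ofReal (l1dist (x j) (x j)))) := by
      refine tendsto_finsetSum _ fun j _ => ENNReal.tendsto_ofReal ?_
      have hj : Tendsto (fun k => u k j) atTop (𝓝 (x j)) := (tendsto_pi_nhds.1 hux) j
      have hc : Continuous fun z => l1dist z (x j) :=
        continuous_l1dist.comp (continuous_id.prodMk continuous_const)
      exact (hc.tendsto (x j)).comp hj
    have h1 : ∑ j, ENNReal.ofReal (l1dist (x j) (x j)) = 0 := by simp [l1dist]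
    rw [h1] at h0
    have h2 := (ENNReal.Tendsto.const_mul (a := (N : ℝ≥0∞)⁻¹) h0 (Or.inr (by simpa))).const_add r
    simpa using h2
  exact ge_of_tendsto' hD fun k => (wasserstein_empirical_le G (u k) x).trans (by
    gcongr
    exact hu k)

/-- The infimum defining the confidence radius is attained. -/
lemma le_measure_confRadius (hN : N ≠ 0) {K : Set (Fin n → ℝ)} (hK : IsCompact K)
    {G : Measure (Fin n → ℝ)} (hG : G ∈ probOn K) {β : ℝ} (hβ : 0 < β) :
    ENNReal.ofReal (1 - β) ≤ (Measure.pi fun _ : Fin N => G)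
      {x | wasserstein G (empirical x) ≤ ENNReal.ofReal (confRadius G N β)} := by
  have := hG.1
  set S : ℝ → Set (Fin N → (Fin n → ℝ)) :=
    fun r => {x | wasserstein G (empirical x) ≤ ENNReal.ofReal r} with hS
  set R : Set ℝ := {r | 0 ≤ r ∧ ENNReal.ofReal (1 - β) ≤ (Measure.pi fun _ : Fin N => G) (S r)}
    with hR
  have hmono : Monotone S := fun r s hrs x hx => le_trans hx (ENNReal.ofReal_le_ofReal hrs)
  have hne : R.Nonempty := by
    -- Distances are finite, so these events exhaust the sample space and some probability exceeds
    -- `1 - β < 1`.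
    have hU : ⋃ k : ℕ, S k = Set.univ := by
      refine Set.eq_univ_of_forall fun x => Set.mem_iUnion.2 ?_
      have hlt := wasserstein_empirical_lt_top hN hK hG x
      obtain ⟨k, hk⟩ := exists_nat_ge (wasserstein G (empirical x)).toReal
      exact ⟨k, (ENNReal.le_ofReal_iff_toReal_le hlt.ne (Nat.cast_nonneg k)).2 hk⟩
    have ht := tendsto_measure_iUnion_atTop (μ := Measure.pi fun _ : Fin N => G)
      (s := fun k : ℕ => S k) fun a b hab => hmono (Nat.cast_le.2 hab)
    rw [hU, measure_univ] at ht
    have hlt : ENNReal.ofReal (1 - β) < 1 := by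
      rw [← ENNReal.ofReal_one]
      exact (ENNReal.ofReal_lt_ofReal_iff one_pos).2 (by linarith)
    obtain ⟨k, hk⟩ := (ht.eventually (lt_mem_nhds hlt)).exists
    exact ⟨k, Nat.cast_nonneg k, hk.le⟩
  have hconf : confRadius G N β = sInf R := rfl
  rw [hconf]
  have hbdd : BddBelow R := ⟨0, fun r hr => hr.1⟩
  obtain ⟨u, hu_anti, hu_lim, hu_mem⟩ := exists_seq_tendsto_sInf hne hbdd
  -- The non-strict inequality survives the limit of radii, so continuity from above applies.
  have hInter : ⋂ k, S (u k) = S (sInf R) := by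
    refine Set.Subset.antisymm (fun x hx => ?_)
      (Set.subset_iInter fun k => hmono (csInf_le hbdd (hu_mem k)))
    exact ge_of_tendsto' (ENNReal.tendsto_ofReal hu_lim) fun k => Set.mem_iInter.1 hx k
  have ht := tendsto_measure_iInter_atTop (μ := Measure.pi fun _ : Fin N => G)
    (s := fun k => S (u k))
    (fun k => (isClosed_wasserstein_empirical_le G hN _).measurableSet.nullMeasurableSet)
    (fun a b hab => hmono (hu_anti hab)) ⟨0, measure_ne_top _ _⟩
  rw [hInter] at ht
  exact ge_of_tendsto' ht fun k => (hu_mem k).2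

/-- Almost surely, a distribution with compact support eventually lies in the Wasserstein balls
around its empirical distributions, provided that the radii dominate the confidence radii for a
summable sequence of confidence levels. -/
lemma ae_eventually_wasserstein_empirical_le {K : Set (Fin n → ℝ)} (hK : IsCompact K)
    {G : Measure (Fin n → ℝ)} (hG : G ∈ probOn K) {β : ℕ → ℝ} (hβ : ∀ N, 1 ≤ N → 0 < β N)
    (hβ_sum : Summable β) {ε : ℕ → ℝ} (hε : ∀ N, 1 ≤ N → confRadius G N (β N) ≤ ε N)
    {Ω : Type*} [MeasurableSpace Ω] {P : Measure Ω} [IsProbabilityMeasure P]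
    {S : ℕ → Ω → (Fin n → ℝ)} (hS_law : ∀ j, HasLaw (S j) G P) (hS_indep : iIndepFun S P) :
    ∀ᵐ ω ∂P, ∀ᶠ N in atTop,
      wasserstein G (empirical fun j : Fin N => S j ω) ≤ ENNReal.ofReal (ε N) := by
  have := hG.1
  have hbound : ∀ N, 1 ≤ N → P {ω | ¬ wasserstein G (empirical fun j : Fin N => S j ω) ≤
      ENNReal.ofReal (ε N)} ≤ ENNReal.ofReal (β N) := by
    intro N hN
    set A : Set (Fin N → (Fin n → ℝ)) :=
      {x | wasserstein G (empirical x) ≤ ENNReal.ofReal (ε N)} with hA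
    have hAm : MeasurableSet A :=
      (isClosed_wasserstein_empirical_le G (by omega) _).measurableSet
    have hmap : P.map (fun ω (j : Fin N) => S j ω) = Measure.pi fun _ : Fin N => G := by
      rw [(hS_indep.precomp Fin.val_injective).map_fun_eq_pi_map
        fun j : Fin N => (hS_law j).aemeasurable]
      simp only [fun j => (hS_law j).map_eq]
    have haem : AEMeasurable (fun ω (j : Fin N) => S j ω) P :=
      aemeasurable_pi_lambda _ fun j => (hS_law j).aemeasurable
    have h1 : ENNReal.ofReal (1 - β N) ≤ (Measure.pi fun _ : Fin N => G) A :=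
      (le_measure_confRadius (by omega) hK hG (hβ N hN)).trans
        (measure_mono fun x hx => le_trans hx (ENNReal.ofReal_le_ofReal (hε N hN)))
    have h2 : P {ω | ¬ wasserstein G (empirical fun j : Fin N => S j ω) ≤ ENNReal.ofReal (ε N)}
        = (Measure.pi fun _ : Fin N => G) Aᶜ := by
      rw [← hmap, Measure.map_apply_of_aemeasurable haem hAm.compl]
      rfl
    rw [h2, prob_compl_eq_one_sub hAm]
    refine tsub_le_iff_right.2 ?_
    calc (1 : ℝ≥0∞) = ENNReal.ofReal (β N + (1 - β N)) := by simp
      _ ≤ ENNReal.ofReal (β N) + ENNReal.ofReal (1 - β N) := ENNReal.ofReal_add_le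
      _ ≤ _ := by gcongr
  -- The index is shifted because nothing is assumed at `N = 0`.
  have hsum : ∑' N, P {ω | ¬ wasserstein G (empirical fun j : Fin (N + 1) => S j ω) ≤
      ENNReal.ofReal (ε (N + 1))} ≠ ∞ := by
    refine ne_top_of_le_ne_top ((summable_nat_add_iff 1).2 hβ_sum).tsum_ofReal_ne_top ?_
    exact ENNReal.tsum_le_tsum fun N => hbound (N + 1) (by omega)
  filter_upwards [ae_eventually_notMem hsum] with ω hω
  obtain ⟨M, hM⟩ := eventually_atTop.1 hω
  refine eventually_atTop.2 ⟨M + 1, fun N hN => ?_⟩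
  obtain ⟨k, rfl⟩ : ∃ k, N = k + 1 := ⟨N - 1, by omega⟩
  exact not_not.1 (hM k (by omega))

/-- The easy half of Kantorovich duality. -/
lemma enorm_integral_sub_le_wasserstein {E : Type*} [NormedAddCommGroup E] [NormedSpace ℝ E]
    {μ ν : Measure (Fin n → ℝ)} {f : (Fin n → ℝ) → E} (hμ : Integrable f μ) (hν : Integrable f ν)
    {L : ℝ} (hL : 0 < L) (hf : ∀ x y, ‖f x - f y‖ ≤ L * l1dist x y) :
    ‖∫ x, f x ∂μ - ∫ x, f x ∂ν‖ₑ ≤ ENNReal.ofReal L * wasserstein μ ν := by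
  -- A nonzero finite factor commutes with infima in `ℝ≥0∞`, even over an empty set of couplings.
  have h0 : ENNReal.ofReal L ≠ 0 := by simpa
  rw [wasserstein, ENNReal.mul_iInf_of_ne h0 ENNReal.ofReal_ne_top]
  refine le_iInf fun π => ?_
  rw [ENNReal.mul_iInf_of_ne h0 ENNReal.ofReal_ne_top]
  refine le_iInf fun ⟨h1, h2⟩ => ?_
  subst h1 h2
  have i1 : Integrable (fun p => f p.1) π := hμ.comp_measurable measurable_fst
  have i2 : Integrable (fun p => f p.2) π := hν.comp_measurable measurable_snd
  rw [integral_map measurable_fst.aemeasurable hμ.aestronglyMeasurable,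
    integral_map measurable_snd.aemeasurable hν.aestronglyMeasurable,
    ← integral_sub i1 i2, ← lintegral_const_mul _ measurable_ofReal_l1dist]
  refine (enorm_integral_le_lintegral_enorm _).trans (lintegral_mono fun p => ?_)
  rw [← ofReal_norm, ← ENNReal.ofReal_mul hL.le]
  exact ENNReal.ofReal_le_ofReal (hf _ _)

end Wasserstein

/-! ### Characteristic functions, deconvolution and weak convergence -/

section CharacteristicFunction

open Complex

variable {n : ℕ}

/-- The characteristic function of a measure on `Fin n → ℝ`, in coordinates. -/
noncomputable def coordCharFun (Q : Measure (Fin n → ℝ)) (t : Fin n → ℝ) : ℂ :=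
  ∫ x, cexp ((t ⬝ᵥ x : ℝ) * I) ∂Q

lemma continuous_dotProduct_right (t : Fin n → ℝ) : Continuous fun x : Fin n → ℝ => t ⬝ᵥ x := by
  unfold dotProduct
  fun_prop

lemma continuous_cexp_dotProduct (t : Fin n → ℝ) :
    Continuous fun x : Fin n → ℝ => cexp ((t ⬝ᵥ x : ℝ) * I) := by
  have := continuous_dotProduct_right t
  fun_prop

lemma integrable_cexp_dotProduct (Q : Measure (Fin n → ℝ)) [IsFiniteMeasure Q] (t : Fin n → ℝ) :
    Integrable (fun x => cexp ((t ⬝ᵥ x : ℝ) * I)) Q := by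
  refine Integrable.of_bound (continuous_cexp_dotProduct t).aestronglyMeasurable 1 ?_
  exact ae_of_all _ fun x => (norm_exp_ofReal_mul_I _).le

lemma norm_cexp_mul_I_sub_le (a b : ℝ) : ‖cexp (a * I) - cexp (b * I)‖ ≤ |a - b| := by
  have h : cexp (a * I) - cexp (b * I) = cexp (b * I) * (cexp (I * (a - b : ℝ)) - 1) := by
    rw [mul_sub, ← Complex.exp_add, mul_one]
    congr 2
    push_cast
    ring
  rw [h, norm_mul, norm_exp_ofReal_mul_I, one_mul]
  exact Real.norm_exp_I_mul_ofReal_sub_one_le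

/-- The extra 1 keeps the Lipschitz constant positive at `t = 0`, as
`enorm_integral_sub_le_wasserstein` requires. -/
lemma abs_dotProduct_sub_le (t x y : Fin n → ℝ) :
    |t ⬝ᵥ x - t ⬝ᵥ y| ≤ (1 + ∑ i, |t i|) * l1dist x y := by
  rw [← dotProduct_sub, dotProduct, l1dist, Finset.mul_sum]
  refine (Finset.abs_sum_le_sum_abs _ _).trans (Finset.sum_le_sum fun i _ => ?_)
  rw [abs_mul]
  refine mul_le_mul_of_nonneg_right ?_ (abs_nonneg _)
  have := Finset.single_le_sum (f := fun i => |t i|) (fun i _ => abs_nonneg _) (Finset.mem_univ i)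
  linarith

lemma coordCharFun_noiseOp (FE Q : Measure (Fin n → ℝ)) [IsProbabilityMeasure FE]
    [IsProbabilityMeasure Q] (t : Fin n → ℝ) :
    coordCharFun (noiseOp FE Q) t = coordCharFun Q t * coordCharFun FE t := by
  rw [noiseOp_eq_conv, coordCharFun, integral_conv (integrable_cexp_dotProduct _ t)]
  simp_rw [dotProduct_add, ofReal_add, add_mul, Complex.exp_add, integral_const_mul,
    integral_mul_const]
  rfl

lemma charFun_map_toLp (Q : Measure (Fin n → ℝ)) (t : EuclideanSpace ℝ (Fin n)) :
    charFun (Q.map (WithLp.toLp 2)) t = coordCharFun Q t.ofLp := by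
  rw [charFun_apply, integral_map (by fun_prop) (by fun_prop), coordCharFun]
  simp [EuclideanSpace.inner_eq_star_dotProduct]

/-- The characteristic function of a compactly supported distribution is nonzero near any point of
a line through the origin, the point itself excepted. -/
lemma eventually_coordCharFun_smul_ne_zero {K : Set (Fin n → ℝ)} (hK : IsCompact K)
    {Q : Measure (Fin n → ℝ)} (hQ : Q ∈ probOn K) (t : Fin n → ℝ) :
    ∀ᶠ s : ℝ in 𝓝[≠] 1, coordCharFun Q (s • t) ≠ 0 := by
  have := hQ.1
  obtain ⟨C, hC⟩ := (hK.image (continuous_dotProduct_right t).abs).bddAbove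
  -- Bounded support makes all exponential moments finite, so the complex moment generating function
  -- is entire.
  have hset : integrableExpSet (fun x => t ⬝ᵥ x) Q = Set.univ := by
    refine Set.eq_univ_of_forall fun u => ?_
    refine Integrable.of_bound (C := Real.exp (|u| * C)) ?_ ?_
    · exact (Real.continuous_exp.comp
        (continuous_const.mul (continuous_dotProduct_right t))).aestronglyMeasurable
    · filter_upwards [mem_ae_iff.2 hQ.2] with x hx
      rw [Real.norm_eq_abs, Real.abs_exp, Real.exp_le_exp]
      have h1 : |t ⬝ᵥ x| ≤ C := hC ⟨x, hx, rfl⟩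
      calc u * t ⬝ᵥ x ≤ |u * t ⬝ᵥ x| := le_abs_self _
        _ = |u| * |t ⬝ᵥ x| := abs_mul _ _
        _ ≤ |u| * C := by gcongr
  have han : AnalyticOnNhd ℂ (complexMGF (fun x => t ⬝ᵥ x) Q) Set.univ := fun z _ =>
    analyticAt_complexMGF (by simp [hset])
  have heq : ∀ s : ℝ, coordCharFun Q (s • t) = complexMGF (fun x => t ⬝ᵥ x) Q (s * I) := by
    intro s
    rw [coordCharFun, complexMGF]
    congr with x
    rw [smul_dotProduct, smul_eq_mul]
    push_cast
    ring_nf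
  -- Local vanishing would force global vanishing, against the value 1 at the origin.
  have hne : ∀ᶠ z in 𝓝[≠] (((1 : ℝ) : ℂ) * I), complexMGF (fun x => t ⬝ᵥ x) Q z ≠ 0 := by
    refine ((han (((1 : ℝ) : ℂ) * I)
      (Set.mem_univ _)).eventually_eq_zero_or_eventually_ne_zero).resolve_left fun h0 => ?_
    have hzero := han.eq_of_eventuallyEq (fun z _ => analyticAt_const (v := (0 : ℂ))) h0
    have h1 := congrFun hzero 0
    simp [complexMGF] at h1
  have hlim : Tendsto (fun s : ℝ => (s : ℂ) * I) (𝓝[≠] 1) (𝓝[≠] (((1 : ℝ) : ℂ) * I)) := by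
    refine tendsto_nhdsWithin_iff.2 ⟨?_, ?_⟩
    · exact ((continuous_ofReal.mul continuous_const).tendsto (1 : ℝ)).mono_left nhdsWithin_le_nhds
    · filter_upwards [self_mem_nhdsWithin] with s hs h
      exact hs (ofReal_injective (mul_right_cancel₀ I_ne_zero h))
  filter_upwards [hlim.eventually hne] with s hs
  rwa [heq]

/-- The bound is uniform in `Q`; this equicontinuity bridges the zeros of the noise factor. -/
lemma norm_coordCharFun_smul_sub_le {K : Set (Fin n → ℝ)} {t : Fin n → ℝ} {C : ℝ}
    (hC : ∀ x ∈ K, |t ⬝ᵥ x| ≤ C) {Q : Measure (Fin n → ℝ)} (hQ : Q ∈ probOn K) (s : ℝ) :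
    ‖coordCharFun Q (s • t) - coordCharFun Q t‖ ≤ |s - 1| * C := by
  have := hQ.1
  rw [coordCharFun, coordCharFun,
    ← integral_sub (integrable_cexp_dotProduct _ _) (integrable_cexp_dotProduct _ _)]
  refine (norm_integral_le_of_norm_le_const (C := |s - 1| * C) ?_).trans (by simp)
  filter_upwards [mem_ae_iff.2 hQ.2] with x hx
  refine (norm_cexp_mul_I_sub_le _ _).trans ?_
  rw [smul_dotProduct, smul_eq_mul, ← sub_one_mul, abs_mul]
  exact mul_le_mul_of_nonneg_left (hC x hx) (abs_nonneg _)

/-- Deconvolution: for compactly supported distributions, convergence of the characteristic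
functions of the noisy marginals implies that of the latent distributions. -/
lemma tendsto_coordCharFun_of_noiseOp {K K' : Set (Fin n → ℝ)} (hK : IsCompact K)
    (hK' : IsCompact K') {FE F : Measure (Fin n → ℝ)} (hFE : FE ∈ probOn K') (hF : F ∈ probOn K)
    {Q : ℕ → Measure (Fin n → ℝ)} (hQ : ∀ k, Q k ∈ probOn K)
    (h : ∀ t, Tendsto (fun k => coordCharFun (noiseOp FE (Q k)) t) atTop
      (𝓝 (coordCharFun (noiseOp FE F) t))) (t : Fin n → ℝ) :
    Tendsto (fun k => coordCharFun (Q k) t) atTop (𝓝 (coordCharFun F t)) := by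
  have := hF.1
  have := hFE.1
  have := fun k => (hQ k).1
  obtain ⟨C, hC⟩ := (hK.image (continuous_dotProduct_right t).abs).bddAbove
  have hC' : ∀ x ∈ K, |t ⬝ᵥ x| ≤ C := fun x hx => hC ⟨x, hx, rfl⟩
  rw [Metric.tendsto_atTop']
  intro δ hδ
  have hsmall : ∀ᶠ s : ℝ in 𝓝[≠] 1, |s - 1| * C < δ / 3 := by
    have hc : Continuous fun s : ℝ => |s - 1| * C := by fun_prop
    refine ((hc.tendsto 1).mono_left nhdsWithin_le_nhds).eventually (gt_mem_nhds ?_)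
    simpa using hδ
  -- One `s`, independent of `k`, serves both to divide by the noise factor and to return to `t`.
  obtain ⟨s, hs0, hs⟩ := ((eventually_coordCharFun_smul_ne_zero hK' hFE t).and hsmall).exists
  have hlim : Tendsto (fun k => coordCharFun (Q k) (s • t)) atTop (𝓝 (coordCharFun F (s • t))) := by
    have h1 := (h (s • t)).div_const (coordCharFun FE (s • t))
    simp_rw [coordCharFun_noiseOp, mul_div_cancel_right₀ _ hs0] at h1
    exact h1
  obtain ⟨k₀, hk₀⟩ := Metric.tendsto_atTop.1 hlim (δ / 3) (by positivity)
  refine ⟨k₀, fun k hk => ?_⟩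
  have h1 := norm_coordCharFun_smul_sub_le hC' (hQ k) s
  have h2 := norm_coordCharFun_smul_sub_le hC' hF s
  have h3 := hk₀ k hk.le
  rw [← dist_eq_norm, dist_comm] at h1
  rw [← dist_eq_norm] at h2
  have h4 := dist_triangle4 (coordCharFun (Q k) t) (coordCharFun (Q k) (s • t))
    (coordCharFun F (s • t)) (coordCharFun F t)
  linarith

/-- The Lévy continuity theorem for distributions on a common compact set. -/
lemma tendsto_integral_of_tendsto_coordCharFun {K : Set (Fin n → ℝ)} (hK : IsCompact K)
    {F : Measure (Fin n → ℝ)} (hF : F ∈ probOn K)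
    {Q : ℕ → Measure (Fin n → ℝ)} (hQ : ∀ k, Q k ∈ probOn K)
    (h : ∀ t, Tendsto (fun k => coordCharFun (Q k) t) atTop (𝓝 (coordCharFun F t)))
    {f : (Fin n → ℝ) → ℝ} (hf : Continuous f) :
    Tendsto (fun k => ∫ x, f x ∂(Q k)) atTop (𝓝 (∫ x, f x ∂F)) := by
  have := hF.1
  have := fun k => (hQ k).1
  have hm : Measurable (WithLp.toLp 2 : (Fin n → ℝ) → EuclideanSpace ℝ (Fin n)) := by fun_prop
  let ν : ℕ → ProbabilityMeasure (EuclideanSpace ℝ (Fin n)) := fun k =>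
    ⟨(Q k).map (WithLp.toLp 2), Measure.isProbabilityMeasure_map hm.aemeasurable⟩
  let ν₀ : ProbabilityMeasure (EuclideanSpace ℝ (Fin n)) :=
    ⟨F.map (WithLp.toLp 2), Measure.isProbabilityMeasure_map hm.aemeasurable⟩
  have hν : Tendsto ν atTop (𝓝 ν₀) := by
    refine ProbabilityMeasure.tendsto_of_tendsto_charFun fun t => ?_
    simp only [ν, ν₀, ProbabilityMeasure.coe_mk, charFun_map_toLp]
    exact h t.ofLp
  obtain ⟨C, hC⟩ := (hK.image hf.abs).bddAbove
  -- Clamping yields a bounded test function that agrees with `f` on `K`. The bound `|C|` below also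
  -- covers a negative `C`.
  have hcont : Continuous fun x : EuclideanSpace ℝ (Fin n) => max (-C) (min C (f x.ofLp)) := by
    fun_prop
  let g : BoundedContinuousFunction (EuclideanSpace ℝ (Fin n)) ℝ :=
    BoundedContinuousFunction.ofNormedAddCommGroup _ hcont |C| fun x => by
      rw [Real.norm_eq_abs]
      rcases le_total 0 C with h0 | h0
      · rw [abs_of_nonneg h0, abs_le]
        exact ⟨le_max_left _ _, max_le (by linarith) (min_le_left _ _)⟩
      · have : max (-C) (min C (f x.ofLp)) = -C :=
          max_eq_left ((min_le_left _ _).trans (by linarith))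
        rw [this, abs_neg]
  have hg : ∀ G ∈ probOn K, ∫ x, g x ∂(G.map (WithLp.toLp 2)) = ∫ x, f x ∂G := by
    intro G hG
    refine (integral_map hm.aemeasurable hcont.aestronglyMeasurable).trans ?_
    refine integral_congr_ae ?_
    filter_upwards [mem_ae_iff.2 hG.2] with x hx
    have h1 : |f x| ≤ C := hC ⟨x, hx, rfl⟩
    rw [abs_le] at h1
    change max (-C) (min C (f x)) = f x
    rw [min_eq_right h1.2, max_eq_right h1.1]
  have hlim := (ProbabilityMeasure.tendsto_iff_forall_integral_tendsto.1 hν) g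
  simp only [ν, ν₀, ProbabilityMeasure.coe_mk, hg _ hF, hg _ (hQ _)] at hlim
  exact hlim

/-- Distributions whose noisy marginals are Wasserstein-close to reference distributions to which
the noisy marginal of `F` is also close have asymptotically the same integrals as `F`. -/
lemma tendsto_integral_of_wasserstein_noiseOp_le {K K' : Set (Fin n → ℝ)} (hK : IsCompact K)
    (hK' : IsCompact K') {FE F : Measure (Fin n → ℝ)} (hFE : FE ∈ probOn K') (hF : F ∈ probOn K)
    {ν : ℕ → Measure (Fin n → ℝ)} (hν : ∀ᶠ k in atTop, IsProbabilityMeasure (ν k))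
    {ε : ℕ → ℝ} (hε : Tendsto ε atTop (𝓝 0))
    (hFν : ∀ᶠ k in atTop, wasserstein (noiseOp FE F) (ν k) ≤ ENNReal.ofReal (ε k))
    {Q : ℕ → Measure (Fin n → ℝ)} (hQ : ∀ k, Q k ∈ probOn K)
    (hQν : ∀ᶠ k in atTop, wasserstein (noiseOp FE (Q k)) (ν k) ≤ ENNReal.ofReal (ε k))
    {f : (Fin n → ℝ) → ℝ} (hf : Continuous f) :
    Tendsto (fun k => ∫ x, f x ∂(Q k)) atTop (𝓝 (∫ x, f x ∂F)) := by
  have := hFE.1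
  have hprob : ∀ G ∈ probOn K, IsProbabilityMeasure (noiseOp FE G) := fun G hG => by
    have := hG.1
    rw [noiseOp_eq_conv]
    infer_instance
  refine tendsto_integral_of_tendsto_coordCharFun hK hF hQ
    (tendsto_coordCharFun_of_noiseOp hK hK' hFE hF hQ fun t => ?_) hf
  have hLpos : 0 < 1 + ∑ i, |t i| := add_pos_of_pos_of_nonneg one_pos
    (Finset.sum_nonneg fun _ _ => abs_nonneg _)
  have key : ∀ k, IsProbabilityMeasure (ν k) → ∀ G ∈ probOn K,
      wasserstein (noiseOp FE G) (ν k) ≤ ENNReal.ofReal (ε k) →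
      ‖coordCharFun (noiseOp FE G) t - coordCharFun (ν k) t‖ₑ ≤
        ENNReal.ofReal (1 + ∑ i, |t i|) * ENNReal.ofReal (ε k) := by
    intro k hk G hG hle
    have := hprob G hG
    refine (enorm_integral_sub_le_wasserstein (integrable_cexp_dotProduct _ t)
      (integrable_cexp_dotProduct _ t) hLpos fun x y =>
        (norm_cexp_mul_I_sub_le _ _).trans (abs_dotProduct_sub_le t x y)).trans ?_
    gcongr
  rw [tendsto_iff_edist_tendsto_0]
  have hz : Tendsto (fun k => ENNReal.ofReal (1 + ∑ i, |t i|) * ENNReal.ofReal (ε k) +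
      ENNReal.ofReal (1 + ∑ i, |t i|) * ENNReal.ofReal (ε k)) atTop (𝓝 0) := by
    have h1 := ENNReal.Tendsto.const_mul (a := ENNReal.ofReal (1 + ∑ i, |t i|))
      (ENNReal.tendsto_ofReal hε) (Or.inr ENNReal.ofReal_ne_top)
    simpa using h1.add h1
  refine tendsto_of_tendsto_of_tendsto_of_le_of_le' tendsto_const_nhds hz
    (Eventually.of_forall fun _ => zero_le) ?_
  filter_upwards [hν, hFν, hQν] with k hk h1 h2
  refine (edist_triangle_right _ _ (coordCharFun (ν k) t)).trans ?_
  rw [edist_eq_enorm_sub, edist_eq_enorm_sub]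
  exact add_le_add (key k hk _ (hQ k) h2) (key k hk _ hF h1)

end CharacteristicFunction

/-! ### Convergence of optimal values and of optimizers -/

variable {n : ℕ}

lemma noiseOp_mem_probOn {K K' : Set (Fin n → ℝ)} (hK' : MeasurableSet K')
    {FE F : Measure (Fin n → ℝ)} [IsProbabilityMeasure FE] (hF : F ∈ probOn K)
    (hFE : ∀ x ∈ K, obsDist FE x ∈ probOn K') : noiseOp FE F ∈ probOn K' := by
  have := hF.1
  refine ⟨by rw [noiseOp_eq_conv]; infer_instance, ?_⟩
  rw [noiseOp_apply FE F hK'.compl]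
  refine lintegral_eq_zero_of_ae_eq_zero ?_
  filter_upwards [mem_ae_iff.2 hF.2] with x hx
  exact (hFE x hx).2

/-- A single translate of the noise with compact support suffices to confine the noise itself. -/
lemma exists_isCompact_mem_probOn {K : Set (Fin n → ℝ)} (hK : IsCompact K)
    {FE : Measure (Fin n → ℝ)} [IsProbabilityMeasure FE] {x : Fin n → ℝ}
    (hx : obsDist FE x ∈ probOn K) : ∃ K', IsCompact K' ∧ FE ∈ probOn K' := by
  refine ⟨(fun e => x + e) ⁻¹' K, (Homeomorph.addLeft x).isCompact_preimage.2 hK, inferInstance, ?_⟩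
  rw [← hx.2, obsDist_apply FE x hK.measurableSet.compl]
  rfl

lemma continuous_utility {U : ℝ → ℝ} (hU : Continuous U) (w : Fin n → ℝ) :
    Continuous fun x : Fin n → ℝ => U (w ⬝ᵥ x) :=
  hU.comp (continuous_dotProduct_right w)

lemma continuous_expUtility {K : Set (Fin n → ℝ)} (hK : IsCompact K) {F : Measure (Fin n → ℝ)}
    (hF : F ∈ probOn K) {U : ℝ → ℝ} (hU : Continuous U) : Continuous (expUtility U F) := by
  have := hF.1
  have hcont : Continuous fun p : (Fin n → ℝ) × (Fin n → ℝ) => U (p.1 ⬝ᵥ p.2) := by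
    refine hU.comp ?_
    unfold dotProduct
    fun_prop
  refine continuous_iff_continuousAt.2 fun w => ?_
  -- Compactness gives a constant dominating the integrand for all decisions near `w`.
  obtain ⟨C, hC⟩ := (((isCompact_closedBall w 1).prod hK).image hcont.abs).bddAbove
  refine continuousAt_of_dominated (bound := fun _ => C)
    (Eventually.of_forall fun v => (continuous_utility hU v).aestronglyMeasurable) ?_
    (integrable_const C) (ae_of_all _ fun x => ?_)
  · filter_upwards [Metric.closedBall_mem_nhds w one_pos] with v hv
    filter_upwards [mem_ae_iff.2 hF.2] with x hx
    exact hC ⟨(v, x), ⟨hv, hx⟩, rfl⟩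
  · exact (hcont.comp (continuous_id.prodMk continuous_const)).continuousAt

lemma worstCase_le_expUtility {X Xs : Set (Fin n → ℝ)} {FE F ν : Measure (Fin n → ℝ)} {U : ℝ → ℝ}
    {ε : ℝ} (h : F ∈ noisyBall X Xs FE ε ν) (w : Fin n → ℝ) :
    worstCase X Xs FE U ε ν w ≤ expUtility U F w :=
  iInf₂_le _ h

/-- Any level below the true expected utility of a decision is eventually a lower bound of its
worst-case expected utility. -/
lemma eventually_le_worstCase {X Xs K' : Set (Fin n → ℝ)} (hX : IsCompact X) (hK' : IsCompact K')
    {FE F : Measure (Fin n → ℝ)} (hFE : FE ∈ probOn K') (hF : F ∈ probOn X)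
    {U : ℝ → ℝ} (hU : Continuous U)
    {ν : ℕ → Measure (Fin n → ℝ)} (hν : ∀ᶠ k in atTop, IsProbabilityMeasure (ν k))
    {ε : ℕ → ℝ} (hε : Tendsto ε atTop (𝓝 0))
    (hFν : ∀ᶠ k in atTop, wasserstein (noiseOp FE F) (ν k) ≤ ENNReal.ofReal (ε k))
    {w : Fin n → ℝ} {c : ℝ} (hc : c < expUtility U F w) :
    ∀ᶠ k in atTop, (c : EReal) ≤ worstCase X Xs FE U (ε k) (ν k) w := by
  -- Select a violator of the level `c` when there is one and `F` otherwise. The resulting full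
  -- sequence has integrals tending to a limit above `c`, which rules out violators eventually.
  have hex : ∀ k, ∃ Q ∈ probOn X,
      (Q ∈ noisyBall X Xs FE (ε k) (ν k) ∧ expUtility U Q w < c) ∨
      (Q = F ∧ ∀ Q' ∈ noisyBall X Xs FE (ε k) (ν k), c ≤ expUtility U Q' w) := by
    intro k
    by_cases h : ∃ Q ∈ noisyBall X Xs FE (ε k) (ν k), expUtility U Q w < c
    · obtain ⟨Q, hQ, hlt⟩ := h
      exact ⟨Q, hQ.1, Or.inl ⟨hQ, hlt⟩⟩
    · push Not at h
      exact ⟨F, hF, Or.inr ⟨rfl, h⟩⟩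
  choose Q hQ hQc using hex
  have hlim := tendsto_integral_of_wasserstein_noiseOp_le hX hK' hFE hF hν hε hFν hQ
    (by
      filter_upwards [hFν] with k hk
      rcases hQc k with h | h
      · exact h.1.2.2
      · rwa [h.1]) (continuous_utility hU w)
  filter_upwards [hlim.eventually (lt_mem_nhds hc)] with k hk
  rcases hQc k with h | h
  · exact absurd h.2 (not_lt.2 hk.le)
  · exact le_iInf₂ fun Q' hQ' => EReal.coe_le_coe_iff.2 (h.2 Q' hQ')

/-- For the lower bound one near-optimal `w` is enough, so no uniformity over `W` is needed; the
upper bound holds decision by decision because `F` is feasible. -/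
lemma tendsto_noiseValue {X Xs K' W : Set (Fin n → ℝ)} (hX : IsCompact X) (hK' : IsCompact K')
    {FE F : Measure (Fin n → ℝ)} (hFE : FE ∈ probOn K') (hF : F ∈ probOn X)
    (hFX : noiseOp FE F ∈ probOn Xs) {U : ℝ → ℝ} (hU : Continuous U)
    {ν : ℕ → Measure (Fin n → ℝ)} (hν : ∀ᶠ k in atTop, IsProbabilityMeasure (ν k))
    {ε : ℕ → ℝ} (hε : Tendsto ε atTop (𝓝 0))
    (hFν : ∀ᶠ k in atTop, wasserstein (noiseOp FE F) (ν k) ≤ ENNReal.ofReal (ε k)) :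
    Tendsto (fun k => noiseValue X Xs W FE U (ε k) (ν k)) atTop (𝓝 (soValue W U F)) := by
  refine tendsto_order.2 ⟨fun a ha => ?_, fun a ha => ?_⟩
  · simp only [soValue, lt_iSup_iff] at ha
    obtain ⟨w, hw, haw⟩ := ha
    obtain ⟨c, hac, hcw⟩ := EReal.lt_iff_exists_real_btwn.1 haw
    filter_upwards [eventually_le_worstCase (Xs := Xs) hX hK' hFE hF hU hν hε hFν
      (EReal.coe_lt_coe_iff.1 hcw)] with k hk
    exact hac.trans_le (hk.trans (le_iSup₂ (f := fun w _ => worstCase X Xs FE U (ε k) (ν k) w) w hw))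
  · filter_upwards [hFν] with k hk
    exact (iSup₂_mono fun w _ => worstCase_le_expUtility ⟨hF, hFX, hk⟩ w).trans_lt ha

lemma isSOOptimal_of_mapClusterPt {X Xs W : Set (Fin n → ℝ)} (hX : IsCompact X)
    (hW : IsClosed W) {FE F : Measure (Fin n → ℝ)} (hF : F ∈ probOn X)
    (hFX : noiseOp FE F ∈ probOn Xs) {U : ℝ → ℝ} (hU : Continuous U)
    {ν : ℕ → Measure (Fin n → ℝ)} {ε : ℕ → ℝ}
    (hFν : ∀ᶠ k in atTop, wasserstein (noiseOp FE F) (ν k) ≤ ENNReal.ofReal (ε k))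
    (hlim : Tendsto (fun k => noiseValue X Xs W FE U (ε k) (ν k)) atTop (𝓝 (soValue W U F)))
    {w : ℕ → (Fin n → ℝ)} (hw : ∀ᶠ k in atTop, IsNoiseOptimal X Xs W FE U (ε k) (ν k) (w k))
    {wbar : Fin n → ℝ} (hwbar : MapClusterPt wbar atTop w) : IsSOOptimal W U F wbar := by
  have hmem : wbar ∈ W := hW.mem_of_mapClusterPt hwbar (hw.mono fun k hk => hk.1)
  refine ⟨hmem, le_antisymm (le_iSup₂ (f := fun w _ => (expUtility U F w : EReal)) wbar hmem) ?_⟩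
  refine le_of_forall_lt fun a ha => ?_
  obtain ⟨c, hac, hc⟩ := EReal.lt_iff_exists_real_btwn.1 ha
  refine hac.trans_le (EReal.coe_le_coe_iff.2 ?_)
  -- Eventually `c` lies below the robust value, which at an optimizer is at most its true utility;
  -- so the sequence eventually stays in this closed set.
  have hclosed : IsClosed {v | c ≤ expUtility U F v} :=
    isClosed_le continuous_const (continuous_expUtility hX hF hU)
  refine hclosed.mem_of_mapClusterPt hwbar ?_
  filter_upwards [hw, hFν, hlim.eventually (lt_mem_nhds hc)] with k h1 h2 h3
  have h4 := worstCase_le_expUtility (U := U) ⟨hF, hFX, h2⟩ (w k)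
  rw [h1.2] at h4
  exact EReal.coe_le_coe_iff.1 (h3.le.trans h4)

end NoisyDRO

theorem mainTheorem3 {n : ℕ} (xmin xmax : Fin n → ℝ)
    -- the support of the noisy samples
    (Xs : Set (Fin n → ℝ)) (hXs_compact : IsCompact Xs) (hXs_convex : Convex ℝ Xs)
    (hX_sub : Set.Icc xmin xmax ⊆ Xs)
    -- the latent distribution and the noise distribution
    (F FE : Measure (Fin n → ℝ)) (hF : F ∈ NoisyDRO.probOn (Set.Icc xmin xmax))
    [IsProbabilityMeasure FE]
    (hFE : ∀ x ∈ Set.Icc xmin xmax, NoisyDRO.obsDist FE x ∈ NoisyDRO.probOn Xs)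
    -- the utility function and the feasible set
    (U : ℝ → ℝ) (hU_cont : Continuous U) (hU_conc : ConcaveOn ℝ Set.univ U) (hU_mono : Monotone U)
    (W : Set (Fin n → ℝ))
    (hU_lip : ∀ w ∈ W, ∃ L : ℝ, ∀ x ∈ Set.Icc xmin xmax, ∀ y ∈ Set.Icc xmin xmax,
      |U (w ⬝ᵥ x) - U (w ⬝ᵥ y)| ≤ L * NoisyDRO.l1dist x y)
    -- the confidence levels and the radii
    (β : ℕ → ℝ) (hβ : ∀ N, 1 ≤ N → β N ∈ Set.Ioo (0 : ℝ) 1) (hβ_sum : Summable β)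
    (ε : ℕ → ℝ)
    (hε : ∀ N, 1 ≤ N → NoisyDRO.confRadius (NoisyDRO.noiseOp FE F) N (β N) ≤ ε N)
    (hε_lim : Tendsto ε atTop (𝓝 0))
    -- the i.i.d. noisy samples
    {Ω : Type*} [MeasurableSpace Ω] (P : Measure Ω) [IsProbabilityMeasure P]
    (S : ℕ → Ω → (Fin n → ℝ)) (hS_law : ∀ j, HasLaw (S j) (NoisyDRO.noiseOp FE F) P)
    (hS_indep : iIndepFun S P) :
    (∀ᵐ ω ∂P, Tendsto
      (fun N => NoisyDRO.noiseValue (Set.Icc xmin xmax) Xs W FE U (ε N)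
        (NoisyDRO.empirical fun j : Fin N => S j ω))
      atTop (𝓝 (NoisyDRO.soValue W U F))) ∧
    (IsCompact W → ∀ᵐ ω ∂P, ∀ wN : ℕ → (Fin n → ℝ),
      (∀ N, 1 ≤ N → NoisyDRO.IsNoiseOptimal (Set.Icc xmin xmax) Xs W FE U (ε N)
        (NoisyDRO.empirical fun j : Fin N => S j ω) (wN N)) →
      ∀ wbar, MapClusterPt wbar atTop wN → NoisyDRO.IsSOOptimal W U F wbar) := by
  have hprob := hF.1
  have hX : IsCompact (Set.Icc xmin xmax) := isCompact_Icc
  -- The box carries the mass of `F`, so it is nonempty; a point of it is needed to recover the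
  -- support of `FE`.
  obtain ⟨x₀, hx₀⟩ : (Set.Icc xmin xmax).Nonempty := by
    by_contra h
    have h0 := hF.2
    rw [Set.not_nonempty_iff_eq_empty.1 h, Set.compl_empty, measure_univ] at h0
    exact one_ne_zero h0
  obtain ⟨K', hK', hFEK'⟩ := NoisyDRO.exists_isCompact_mem_probOn hXs_compact (hFE x₀ hx₀)
  have hFX : NoisyDRO.noiseOp FE F ∈ NoisyDRO.probOn Xs :=
    NoisyDRO.noiseOp_mem_probOn hXs_compact.measurableSet hF hFE
  have hball := NoisyDRO.ae_eventually_wasserstein_empirical_le hXs_compact hFX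
    (fun N hN => (hβ N hN).1) hβ_sum hε hS_law hS_indep
  have hemp : ∀ ω, ∀ᶠ N in atTop,
      IsProbabilityMeasure (NoisyDRO.empirical fun j : Fin N => S j ω) := fun ω => by
    filter_upwards [eventually_ne_atTop 0] with N hN
    exact NoisyDRO.isProbabilityMeasure_empirical hN _
  have hval := hball.mono fun ω hω =>
    NoisyDRO.tendsto_noiseValue (W := W) hX hK' hFEK' hF hFX hU_cont (hemp ω) hε_lim hω
  refine ⟨hval, fun hW => ?_⟩
  filter_upwards [hball, hval] with ω hω hvω wN hwN wbar hwbar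
  exact NoisyDRO.isSOOptimal_of_mapClusterPt hX hW.isClosed hF hFX hU_cont hω hvω
    (eventually_atTop.2 ⟨1, hwN⟩) hwbar
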